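/- **Model at time step $k$ (the configuration at time $k-1$ is given).** Let the space $\Theta$ of cluster parameters be standard Borel, $H$ a probability measure on $\Theta$, $\alpha>0$. At time $k-1$ there are $D$ clusters with parameters $\theta^\star_{1},\dots,\theta^\star_{D}$ and cardinalities $v^\star_{j,k-1}$; $v^\star_j$ is the cardinality of cluster $j$ after transitioning, $\lambda_j=1$ if $v^\star_{j,k-1}\ge 1$ and $\lambda_j=0$ otherwise, and clusters with $\lambda_j=1$ are called transitioned. Let $\varphi$ be a Markov kernel on $\Theta$, and let $z\mapsto R(z\mid x,\theta)$ be the probability density, with respect to a $\sigma$-finite measure, of a measurement of an object with state $x$ and cluster parameter $\theta$ (measurable in $(\theta,z)$). There are $N$ objects. Fix the object $\ell$, regarded as the last one to be clustered, and its current state $x_\ell$. Let $w$ collect the cluster assignments, cluster parameters and measurements of the other $N-1$ objects (with an arbitrary joint law). Let $\mathcal C$ be the finite set of clusters occupied by the other objects (old clusters $j\le D$ or clusters newly created at time $k$); for $a\in\mathcal C$ let $v_a$ be the number of other objects in $a$ and $\theta_a$ its parameter; put $v^\star_a\lambda_a=0$ if $a$ is a new cluster. With $$g=(N-1)+\sum_{j=1}^{D}v^\star_j\lambda_j+\alpha,\quad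 \Pi^{(1)}_a=\frac{v_a+v^\star_a\lambda_a}{g},\quad \Pi^{(2)}_j=\frac{v^\star_j\lambda_j}{g},\quad \Pi^{(3)}=\frac{\alpha}{g},$$ let $$H_0(w)=\sum_{a\in\mathcal C}\Pi^{(1)}_a\,\delta_{\theta_a}+\sum_{j\notin\mathcal C,\ \lambda_j=1}\Pi^{(2)}_j\,\varphi(\theta^\star_j,\cdot)+\Pi^{(3)}H .$$ Given $w$, $G\sim \mathrm{DP}(\alpha,H_0(w))$, i.e. $G=\sum_l\pi_l\delta_{\vartheta_l}$ with $\vartheta_l$ i.i.d. from $H_0(w)$ and, independently, $\pi_l=V_l\prod_{i<l}(1-V_i)$, $V_i$ i.i.d. $\mathrm{Beta}(1,\alpha)$; given $(w,G)$, $\theta_\ell\sim G$; given $(w,G,\theta_\ell)$, $z_\ell\sim R(\cdot\mid x_\ell,\theta_\ell)$. **Claim.** For almost every $(w,z_\ell)$, the regular conditional distribution of $\theta_\ell$ given $(w,z_\ell)$, that is, given the parameters (and assignments) of the other objects and all the measurements, is $$\sum_{a\in\mathcal C}\xi_a\,\delta_{\theta_a}+\sum_{j\notin\mathcal C,\ \lambda_j=1}\beta_j\,R_j+\gamma_\ell\,H_\ell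 ,$$ where $R_j(d\theta)\propto R(z_\ell\mid x_\ell,\theta)\,\varphi(\theta^\star_j,d\theta)$ and $H_\ell(d\theta)\propto R(z_\ell\mid x_\ell,\theta)\,H(d\theta)$ are normalized to probability measures (whenever their weights are nonzero) and, with $$p=\sum_{a\in\mathcal C}\Pi^{(1)}_aR(z_\ell\mid x_\ell,\theta_a)+\sum_{j\notin\mathcal C,\ \lambda_j=1}\Pi^{(2)}_j\int R(z_\ell\mid x_\ell,\theta)\,\varphi(\theta^\star_j,d\theta)+\Pi^{(3)}\int R(z_\ell\mid x_\ell,\theta)\,H(d\theta)\in(0,\infty),$$ $$\xi_a=\frac{\Pi^{(1)}_aR(z_\ell\mid x_\ell,\theta_a)}{p},\qquad \beta_j=\frac{\Pi^{(2)}_j\int R(z_\ell\mid x_\ell,\theta)\,\varphi(\theta^\star_j,d\theta)}{p},$$ $$\gamma_\ell=1-\sum_{a\in\mathcal C}\xi_a-\sum_{j\notin\mathcal C,\ \lambda_j=1}\beta_j=\frac{\Pi^{(3)}\int R(z_\ell\mid x_\ell,\theta)\,H(d\theta)}{p}.$$ The weights are nonnegative and sum to $1$. -/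

import Mathlib

open MeasureTheory ProbabilityTheory
open scoped ENNReal NNReal

/-! ### The Dirichlet process (stick-breaking representation) -/

/-- Stick-breaking weight `π_l = V_l ∏_{i<l} (1 - V_i)`. -/
noncomputable def stickWeight (V : ℕ → ℝ) (l : ℕ) : ℝ≥0∞ :=
  ENNReal.ofReal (V l * ∏ i ∈ Finset.range l, (1 - V i))

/-- The discrete measure `∑_l π_l δ_{θ_l}`. -/
noncomputable def stickMeasure {Θ : Type*} [MeasurableSpace Θ] (p : (ℕ → ℝ) × (ℕ → Θ)) :
    Measure Θ :=
  Measure.sum fun l => stickWeight p.1 l • Measure.dirac (p.2 l)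

theorem measurable_stickMeasure {Θ : Type*} [MeasurableSpace Θ] :
    Measurable (stickMeasure (Θ := Θ)) := by
  refine Measure.measurable_of_measurable_coe _ fun s hs => ?_
  have h : ∀ p : (ℕ → ℝ) × (ℕ → Θ), stickMeasure p s =
      ∑' l, stickWeight p.1 l * s.indicator 1 (p.2 l) := by
    intro p
    simp [stickMeasure, Measure.sum_apply _ hs, Measure.dirac_apply' _ hs]
  simp_rw [h]
  refine Measurable.tsum fun l => Measurable.mul ?_ ?_
  · unfold stickWeight
    fun_prop
  · exact (measurable_one.indicator hs).comp (by fun_prop)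

/-- The law of i.i.d. `Beta(1, α)` stick-breaking proportions `V_0, V_1, …`. -/
noncomputable def stickLaw (α : ℝ) (hα : 0 < α) : Measure (ℕ → ℝ) :=
  have := isProbabilityMeasureBeta one_pos hα
  Measure.infinitePi fun _ : ℕ => betaMeasure 1 α

instance (α : ℝ) (hα : 0 < α) : IsProbabilityMeasure (stickLaw α hα) := by
  have := isProbabilityMeasureBeta one_pos hα
  unfold stickLaw
  infer_instance

/-- `DP(α, H)`: the law of `∑_l π_l δ_{θ_l}` with `π ∼ GEM(α)` and, independently, `θ_l` i.i.d.
with law `H`. -/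
noncomputable def dirichletProcess {Θ : Type*} [MeasurableSpace Θ] (α : ℝ) (hα : 0 < α)
    (H : Measure Θ) [IsProbabilityMeasure H] : Measure (Measure Θ) :=
  ((stickLaw α hα).prod (Measure.infinitePi fun _ : ℕ => H)).map stickMeasure

instance {Θ : Type*} [MeasurableSpace Θ] (α : ℝ) (hα : 0 < α)
    (H : Measure Θ) [IsProbabilityMeasure H] : IsProbabilityMeasure (dirichletProcess α hα H) :=
  Measure.isProbabilityMeasure_map measurable_stickMeasure.aemeasurable

/-- I.i.d. sequences drawn from a Markov kernel form a Markov kernel. -/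
noncomputable def iidKernel {A Θ : Type*} [MeasurableSpace A] [MeasurableSpace Θ]
    (κ : Kernel A Θ) [IsMarkovKernel κ] : Kernel A (ℕ → Θ) where
  toFun a := Measure.infinitePi fun _ : ℕ => κ a
  measurable' := by
    refine Measurable.measure_of_isPiSystem_of_isProbabilityMeasure
      (generateFrom_squareCylinders (α := fun _ : ℕ => Θ)).symm
      (isPiSystem_squareCylinders (fun _ => MeasurableSpace.isPiSystem_measurableSet)
        (fun _ => MeasurableSet.univ)) ?_
    rintro _ ⟨s, t, ht, rfl⟩
    have ht' : ∀ i, MeasurableSet (t i) := fun i => ht i (Set.mem_univ i)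
    have h : ∀ a, (Measure.infinitePi fun _ : ℕ => κ a) ((s : Set ℕ).pi t) =
        ∏ i ∈ s, κ a (t i) := fun a => Measure.infinitePi_pi _ fun i _ => ht' i
    simp_rw [h]
    exact Finset.measurable_prod _ fun i _ => Kernel.measurable_coe κ (ht' i)

instance {A Θ : Type*} [MeasurableSpace A] [MeasurableSpace Θ]
    (κ : Kernel A Θ) [IsMarkovKernel κ] : IsMarkovKernel (iidKernel κ) :=
  ⟨fun a => inferInstanceAs (IsProbabilityMeasure (Measure.infinitePi fun _ : ℕ => κ a))⟩

/-- The kernel `a ↦ DP(α, κ a)`. -/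
noncomputable def dpKernel {A Θ : Type*} [MeasurableSpace A] [MeasurableSpace Θ]
    (α : ℝ) (hα : 0 < α) (κ : Kernel A Θ) [IsMarkovKernel κ] : Kernel A (Measure Θ) where
  toFun a := dirichletProcess α hα (κ a)
  measurable' := by
    have h : (fun a => dirichletProcess α hα (κ a)) =
        ((Kernel.const A (stickLaw α hα)) ×ₖ iidKernel κ).map stickMeasure := by
      funext a
      rw [Kernel.map_apply _ measurable_stickMeasure, Kernel.prod_apply]
      rfl
    rw [h]
    exact Kernel.measurable _

instance {A Θ : Type*} [MeasurableSpace A] [MeasurableSpace Θ]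
    (α : ℝ) (hα : 0 < α) (κ : Kernel A Θ) [IsMarkovKernel κ] :
    IsMarkovKernel (dpKernel α hα κ) :=
  ⟨fun a => inferInstanceAs (IsProbabilityMeasure (dirichletProcess α hα (κ a)))⟩

open Classical in
/-- Drawing a point from a random probability measure `G`. (Measures of total mass other than `1`,
which a Dirichlet process avoids almost surely, are sent to `0`.) -/
noncomputable def sampleKernel (Θ : Type*) [MeasurableSpace Θ] : Kernel (Measure Θ) Θ where
  toFun G := if G Set.univ = 1 then G else 0
  measurable' := by
    refine Measurable.ite ?_ measurable_id measurable_const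
    exact (Measure.measurable_coe MeasurableSet.univ) (measurableSet_singleton 1)

instance (Θ : Type*) [MeasurableSpace Θ] : IsFiniteKernel (sampleKernel Θ) := by
  refine ⟨1, ENNReal.one_lt_top, fun G => ?_⟩
  change (if G Set.univ = 1 then G else 0) Set.univ ≤ 1
  split_ifs with h <;> simp [h]

/-! ### The dependent Dirichlet process model at time step `k` -/

/-- Data of the model at time step `k`, the configuration at time step `k - 1` being given.
`Θ` is the space of cluster parameters, `X` that of object states, `Z` that of measurements. -/
structure DDPModel (Θ X Z : Type*) [MeasurableSpace Θ] [MeasurableSpace Z] where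
  /-- concentration parameter -/
  α : ℝ
  α_pos : 0 < α
  /-- base distribution -/
  H : Measure Θ
  H_prob : IsProbabilityMeasure H
  /-- number of clusters at time step `k - 1` -/
  D : ℕ
  /-- cardinality of each cluster at time step `k - 1` -/
  card : Fin D → ℕ
  /-- cardinality `v⋆` of each cluster after transitioning from `k - 1` to `k` -/
  cardTrans : Fin D → ℕ
  /-- parameter of each cluster at time step `k - 1` -/
  param : Fin D → Θ
  /-- transition kernel of the cluster parameters -/
  φ : Kernel Θ Θ
  φ_markov : IsMarkovKernel φ
  /-- reference measure on the measurement space -/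
  ref : Measure Z
  ref_sigmaFinite : SigmaFinite ref
  /-- `R(z | x, θ)`: density in `z` of the measurement of an object with state `x` whose cluster
  parameter is `θ` -/
  R : X → Θ → Z → ℝ≥0
  R_measurable : ∀ x, Measurable (Function.uncurry (R x))
  R_lintegral : ∀ x t, ∫⁻ z, R x t z ∂ref = 1

attribute [instance] DDPModel.H_prob DDPModel.φ_markov DDPModel.ref_sigmaFinite

/-- The objects other than the `ℓ`-th. -/
abbrev Others {N : ℕ} (ℓ : Fin N) : Type := {i : Fin N // i ≠ ℓ}

namespace DDPModel

variable {Θ X Z : Type*} [MeasurableSpace Θ] [MeasurableSpace Z] (M : DDPModel Θ X Z)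

/-- Cluster labels at time step `k`: `Sum.inl j` is the `j`-th cluster of time step `k - 1`, and
`Sum.inr m` are names for clusters newly created at time step `k`. -/
abbrev Label : Type := Fin M.D ⊕ ℕ

instance : MeasurableSingletonClass M.Label := by
  refine ⟨fun a => ?_⟩
  rcases a with j | m
  · rw [← Set.image_singleton]
    exact (measurableSet_singleton j).inl_image
  · rw [← Set.image_singleton]
    exact (measurableSet_singleton m).inr_image

/-- What is known about the objects other than the `ℓ`-th: cluster assignments, cluster
parameters, measurements. -/
abbrev Config {N : ℕ} (ℓ : Fin N) : Type _ :=
  (Others ℓ → M.Label) × (Others ℓ → Θ) × (Others ℓ → Z)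

/-- Cluster transitioning indicator. -/
def lam (j : Fin M.D) : ℕ := if 1 ≤ M.card j then 1 else 0

/-- Contribution of the previous time step to the popularity of a cluster: `v⋆ λ` for a cluster of
time step `k - 1`, and `0` for a new cluster. -/
def transWeight (a : M.Label) : ℕ := Sum.elim (fun j => M.cardTrans j * M.lam j) (fun _ => 0) a

variable {N : ℕ} {ℓ : Fin N}

/-- Clusters occupied by the other objects. -/
def occupied (c : Others ℓ → M.Label) : Finset M.Label := Finset.univ.image c

/-- Transitioned clusters not occupied by any of the other objects. -/
def free (c : Others ℓ → M.Label) : Finset (Fin M.D) :=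
  {j | M.lam j = 1 ∧ Sum.inl j ∉ M.occupied c}

/-- Number of other objects in a cluster at time step `k`. -/
def count (c : Others ℓ → M.Label) (a : M.Label) : ℕ := (Finset.univ.filter fun i => c i = a).card

open Classical in
/-- The parameter of an occupied cluster, i.e. the parameter of an object assigned to it. -/
noncomputable def clusterParam [Nonempty Θ] (w : M.Config ℓ) (a : M.Label) : Θ :=
  if h : ∃ i, w.1 i = a then w.2.1 h.choose else Classical.arbitrary Θ

/-- The constant `g_k`: the total popularity of all the clusters, plus `α`. -/
noncomputable def g (N : ℕ) : ℝ≥0∞ :=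
  ((N - 1 : ℕ) : ℝ≥0∞) + ((∑ j, M.cardTrans j * M.lam j : ℕ) : ℝ≥0∞) + ENNReal.ofReal M.α

/-- Prior probability of joining the occupied cluster `a`. -/
noncomputable def prob₁ (c : Others ℓ → M.Label) (a : M.Label) : ℝ≥0∞ :=
  ((M.count c a + M.transWeight a : ℕ) : ℝ≥0∞) / M.g N

/-- Prior probability of joining the transitioned, not yet occupied cluster `j`. -/
noncomputable def prob₂ (N : ℕ) (j : Fin M.D) : ℝ≥0∞ :=
  ((M.cardTrans j * M.lam j : ℕ) : ℝ≥0∞) / M.g N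

/-- Prior probability of creating a new cluster. -/
noncomputable def prob₃ (N : ℕ) : ℝ≥0∞ := ENNReal.ofReal M.α / M.g N

/-- The base distribution `H₀` of the process that governs the `ℓ`-th object, given the
configuration of the other objects: a point mass at the parameter of each occupied cluster, the
transition kernel started at the former parameter of each transitioned but unoccupied cluster, and
the base distribution `H`. -/
noncomputable def baseMeasure [Nonempty Θ] (w : M.Config ℓ) : Measure Θ :=
  ∑ a ∈ M.occupied w.1, M.prob₁ w.1 a • Measure.dirac (M.clusterParam w a)
    + ∑ j ∈ M.free w.1, M.prob₂ N j • M.φ (M.param j)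
    + M.prob₃ N • M.H

theorem sum_weights (c : Others ℓ → M.Label) :
    ∑ a ∈ M.occupied c, (M.count c a + M.transWeight a) +
      ∑ j ∈ M.free c, M.cardTrans j * M.lam j = (N - 1) + ∑ j, M.cardTrans j * M.lam j := by
  classical
  have h1 : ∑ a ∈ M.occupied c, M.count c a = N - 1 := by
    have h := Finset.card_eq_sum_card_image c (Finset.univ : Finset (Others ℓ))
    have h' : (Finset.univ : Finset (Others ℓ)).card = N - 1 := by
      rw [Finset.card_univ, Fintype.card_subtype_compl]
      simp
    rw [← h', h]
    rfl
  have h2 : ∑ a ∈ M.occupied c, M.transWeight a =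
      ∑ j ∈ Finset.univ.filter (fun j => Sum.inl j ∈ M.occupied c), M.cardTrans j * M.lam j := by
    symm
    refine Finset.sum_of_injOn Sum.inl (fun a _ b _ h => Sum.inl.inj h) ?_ ?_ ?_
    · intro j hj
      simpa using hj
    · rintro (j | m) ha hn
      · exact absurd ⟨j, by simpa using ha, rfl⟩ hn
      · rfl
    · intro j _
      rfl
  have h3 : ∑ j ∈ M.free c, M.cardTrans j * M.lam j =
      ∑ j ∈ Finset.univ.filter (fun j => Sum.inl j ∉ M.occupied c), M.cardTrans j * M.lam j := by
    refine Finset.sum_subset ?_ ?_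
    · intro j hj
      simp only [free, Finset.mem_filter, Finset.mem_univ, true_and] at hj ⊢
      exact hj.2
    · intro j hj hn
      simp only [free, Finset.mem_filter, Finset.mem_univ, true_and, not_and] at hj hn
      have : M.lam j = 0 := by
        by_contra h0
        refine hn ?_ hj
        unfold lam at h0 ⊢
        split_ifs at h0 ⊢ with h
        · rfl
        · exact absurd rfl h0
      simp [this]
  rw [Finset.sum_add_distrib, h1, h2, h3, add_assoc,
    Finset.sum_filter_add_sum_filter_not]

theorem g_ne_zero : M.g N ≠ 0 := by
  have : ENNReal.ofReal M.α ≠ 0 := by simpa using M.α_pos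
  simp [g, this]

theorem g_ne_top : M.g N ≠ ∞ := by
  simp [g, ENNReal.mul_eq_top]

instance [Nonempty Θ] (w : M.Config ℓ) : IsProbabilityMeasure (M.baseMeasure w) := by
  refine ⟨?_⟩
  have h := congrArg (fun n : ℕ => (n : ℝ≥0∞)) (M.sum_weights w.1)
  simp only [Nat.cast_add, Nat.cast_sum] at h
  have e : M.baseMeasure w Set.univ =
      ((∑ a ∈ M.occupied w.1, ((M.count w.1 a + M.transWeight a : ℕ) : ℝ≥0∞)) +
        (∑ j ∈ M.free w.1, ((M.cardTrans j * M.lam j : ℕ) : ℝ≥0∞)) + ENNReal.ofReal M.α)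
          / M.g N := by
    simp only [baseMeasure, prob₁, prob₂, prob₃, Measure.coe_add, Pi.add_apply,
      Measure.finsetSum_apply, Measure.smul_apply, smul_eq_mul, measure_univ, mul_one,
      div_eq_mul_inv, Finset.sum_mul, add_mul]
  rw [e]
  have : (∑ a ∈ M.occupied w.1, ((M.count w.1 a + M.transWeight a : ℕ) : ℝ≥0∞)) +
        (∑ j ∈ M.free w.1, ((M.cardTrans j * M.lam j : ℕ) : ℝ≥0∞)) + ENNReal.ofReal M.α
          = M.g N := by
    simp only [g, Nat.cast_add, Nat.cast_sum] at h ⊢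
    rw [h]
  rw [this]
  exact ENNReal.div_self M.g_ne_zero M.g_ne_top

/-- The base distribution `H₀` as a kernel from configurations. -/
noncomputable def baseKernel [Nonempty Θ] (ℓ : Fin N) : Kernel (M.Config ℓ) Θ where
  toFun := M.baseMeasure
  measurable' := by
    classical
    refine measurable_from_prod_countable_right fun c => ?_
    refine Measure.measurable_of_measurable_coe _ fun s hs => ?_
    simp only [baseMeasure, Measure.coe_add, Pi.add_apply, Measure.finsetSum_apply,
      Measure.smul_apply, smul_eq_mul]
    refine ((Finset.measurable_fun_sum _ fun a _ => ?_).add_const _).add_const _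
    refine Measurable.const_mul ?_ _
    have hm : Measurable fun p : (Others ℓ → Θ) × (Others ℓ → Z) => M.clusterParam (c, p) a := by
      unfold clusterParam
      by_cases h : ∃ i, c i = a
      · simp only [dif_pos h]
        exact (measurable_pi_apply h.choose).comp measurable_fst
      · simp only [dif_neg h]
        exact measurable_const
    exact (Measure.measurable_coe hs).comp (Measure.measurable_dirac.comp hm)

instance [Nonempty Θ] : IsMarkovKernel (M.baseKernel ℓ) :=
  ⟨fun w => inferInstanceAs (IsProbabilityMeasure (M.baseMeasure w))⟩

/-- The measurement distribution of an object in state `x`, as a kernel from its cluster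
parameter: `R(z | x, θ) dz`. -/
noncomputable def measurementKernel (x : X) : Kernel Θ Z :=
  (Kernel.const Θ M.ref).withDensity fun t z => (M.R x t z : ℝ≥0∞)

theorem measurementKernel_apply (x : X) (t : Θ) :
    M.measurementKernel x t = M.ref.withDensity fun z => (M.R x t z : ℝ≥0∞) := by
  have h : Measurable (Function.uncurry fun t z => (M.R x t z : ℝ≥0∞)) :=
    measurable_coe_nnreal_ennreal.comp (M.R_measurable x)
  rw [measurementKernel, Kernel.withDensity_apply _ h, Kernel.const_apply]

instance (x : X) : IsMarkovKernel (M.measurementKernel x) := by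
  refine ⟨fun t => ⟨?_⟩⟩
  rw [measurementKernel_apply, withDensity_apply _ MeasurableSet.univ, Measure.restrict_univ]
  exact M.R_lintegral x t

/-- Joint law of `(((w, G), θ_ℓ), z_ℓ)`: the configuration `w` of the other objects has law `ν`;
given `w`, `G ∼ DP(α, H₀(w))`; given `(w, G)`, `θ_ℓ ∼ G`; given `(w, G, θ_ℓ)`,
`z_ℓ ∼ R(· | x, θ_ℓ)`, where `x` is the state of the `ℓ`-th object. -/
noncomputable def jointLaw [Nonempty Θ] (ℓ : Fin N) (x : X) (ν : Measure (M.Config ℓ)) :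
    Measure (((M.Config ℓ × Measure Θ) × Θ) × Z) :=
  ((ν ⊗ₘ dpKernel M.α M.α_pos (M.baseKernel ℓ)) ⊗ₘ (sampleKernel Θ).prodMkLeft (M.Config ℓ))
    ⊗ₘ (M.measurementKernel x).prodMkLeft (M.Config ℓ × Measure Θ)

/-! ### The posterior mixture -/

/-- Marginal likelihood of the measurement `z` given the configuration of the other objects. -/
noncomputable def evidence [Nonempty Θ] (x : X) (w : M.Config ℓ) (z : Z) : ℝ≥0∞ :=
  ∑ a ∈ M.occupied w.1, M.prob₁ w.1 a * M.R x (M.clusterParam w a) z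
    + ∑ j ∈ M.free w.1, M.prob₂ N j * ∫⁻ t, M.R x t z ∂(M.φ (M.param j))
    + M.prob₃ N * ∫⁻ t, M.R x t z ∂M.H

/-- The probability measure proportional to `R(z | x, θ) μ(dθ)`. -/
noncomputable def likelihoodUpdate (x : X) (z : Z) (μ : Measure Θ) : Measure Θ :=
  (∫⁻ t, M.R x t z ∂μ)⁻¹ • μ.withDensity fun t => (M.R x t z : ℝ≥0∞)

/-- Posterior weight of the occupied cluster `a`. -/
noncomputable def ξ [Nonempty Θ] (x : X) (w : M.Config ℓ) (z : Z) (a : M.Label) : ℝ≥0∞ :=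
  M.prob₁ w.1 a * M.R x (M.clusterParam w a) z / M.evidence x w z

/-- Posterior weight of the transitioned, unoccupied cluster `j`. -/
noncomputable def β [Nonempty Θ] (x : X) (w : M.Config ℓ) (z : Z) (j : Fin M.D) : ℝ≥0∞ :=
  M.prob₂ N j * (∫⁻ t, M.R x t z ∂(M.φ (M.param j))) / M.evidence x w z

/-- Posterior weight of the updated base distribution: the remaining mass. -/
noncomputable def γ [Nonempty Θ] (x : X) (w : M.Config ℓ) (z : Z) : ℝ≥0∞ :=
  1 - ∑ a ∈ M.occupied w.1, M.ξ x w z a - ∑ j ∈ M.free w.1, M.β x w z j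

/-- The mixture of point masses at the existing parameters, likelihood-weighted transition kernels
of the unoccupied transitioned clusters, and the likelihood-updated base distribution. -/
noncomputable def gibbsMixture [Nonempty Θ] (x : X) (w : M.Config ℓ) (z : Z) : Measure Θ :=
  ∑ a ∈ M.occupied w.1, M.ξ x w z a • Measure.dirac (M.clusterParam w a)
    + ∑ j ∈ M.free w.1, M.β x w z j • M.likelihoodUpdate x z (M.φ (M.param j))
    + M.γ x w z • M.likelihoodUpdate x z M.H

end DDPModel

/-! The random measure `G` influences the data only through the single draw `θ_ℓ`, so it can be
integrated out. The mean measure of a Dirichlet process is its base distribution; hence, given `w`,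
the law of `θ_ℓ` is simply `H₀(w)` (`map_compProd_dpKernel_sampleKernel`). What remains is Bayes'
formula for a dominated likelihood: the posterior is `R(z | x, θ) H₀(w)(dθ)`, normalized
(`map_compProd_measurementKernel`). As `H₀(w)` is a finite mixture, its posterior is the mixture of
the posteriors of its components, each weight being multiplied by the evidence of its component and
divided by the total evidence (`likelihoodUpdate_baseMeasure`).

Two points need care. `G` must have mass one almost surely, which follows from the expected
stick-breaking weights forming a geometric series. And the normalization fails where the evidence is
`0` or `∞`; the data law, whose density is the evidence, does not charge that set
(`ae_evidence_mem_Ioo`). -/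

/-! ### Stick-breaking weights -/

theorem ae_mem_Ioo_betaMeasure (a b : ℝ) : ∀ᵐ v ∂(betaMeasure a b), 0 < v ∧ v < 1 := by
  have h : Measurable (betaPDF a b) := (measurable_betaPDFReal a b).ennreal_ofReal
  rw [betaMeasure, ae_withDensity_iff h]
  refine Filter.Eventually.of_forall fun v hv => ?_
  by_contra hn
  exact hv (by rw [betaPDF_eq, if_neg hn, ENNReal.ofReal_zero])

theorem ae_mem_Ioo_stickLaw (α : ℝ) (hα : 0 < α) :
    ∀ᵐ V ∂(stickLaw α hα), ∀ i, 0 < V i ∧ V i < 1 := by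
  have := isProbabilityMeasureBeta one_pos hα
  refine ae_all_iff.2 fun i => ?_
  have h := (measurePreserving_eval_infinitePi (fun _ : ℕ => betaMeasure 1 α) i)
  exact h.quasiMeasurePreserving.ae (ae_mem_Ioo_betaMeasure 1 α)

/-- The expected stick-breaking weights are geometric. -/
theorem lintegral_stickWeight (α : ℝ) (hα : 0 < α) (l : ℕ) :
    ∫⁻ V, stickWeight V l ∂(stickLaw α hα) =
      (∫⁻ v, ENNReal.ofReal v ∂(betaMeasure 1 α)) *
        (∫⁻ v, ENNReal.ofReal (1 - v) ∂(betaMeasure 1 α)) ^ l := by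
  have := isProbabilityMeasureBeta one_pos hα
  -- One family of coordinate functions covers the factor `V l` and the factors `1 - V i` alike, so
  -- that independence applies to a single product over `i ≤ l`.
  set f : ℕ → ℝ → ℝ≥0∞ := fun i v => if i = l then ENNReal.ofReal v else ENNReal.ofReal (1 - v)
    with hf
  have hfm : ∀ i, Measurable (f i) := fun i => by
    simp only [hf]; split_ifs <;> fun_prop
  have e : ∀ᵐ V ∂(stickLaw α hα),
      stickWeight V l = ∏ i ∈ Finset.range (l + 1), f i (V i) := by
    filter_upwards [ae_mem_Ioo_stickLaw α hα] with V hV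
    rw [stickWeight, ENNReal.ofReal_mul (hV l).1.le,
      ENNReal.ofReal_prod_of_nonneg fun i _ => by linarith [(hV i).2],
      Finset.prod_range_succ, mul_comm]
    congr 1
    · refine Finset.prod_congr rfl fun i hi => ?_
      simp [hf, (Finset.mem_range.1 hi).ne]
    · simp [hf]
  have hind : iIndepFun (fun i (V : ℕ → ℝ) => f i (V i)) (stickLaw α hα) :=
    iIndepFun_infinitePi (P := fun _ : ℕ => betaMeasure 1 α) (X := f) hfm
  have hmarg : ∀ i, ∫⁻ V, f i (V i) ∂(stickLaw α hα) = ∫⁻ v, f i v ∂(betaMeasure 1 α) := fun i =>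
    (measurePreserving_eval_infinitePi (fun _ : ℕ => betaMeasure 1 α) i).lintegral_comp (hfm i)
  rw [lintegral_congr_ae e, lintegral_prod_eq_prod_lintegral_of_indepFun _ _ hind
    fun i => (hfm i).comp (measurable_pi_apply i), Finset.prod_range_succ, mul_comm]
  congr 1
  · rw [hmarg]; simp [hf]
  · rw [Finset.prod_congr rfl (g := fun _ => ∫⁻ v, ENNReal.ofReal (1 - v) ∂(betaMeasure 1 α)),
      Finset.prod_const, Finset.card_range]
    intro i hi
    rw [hmarg]
    simp [hf, (Finset.mem_range.1 hi).ne]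

theorem measurable_stickWeight (l : ℕ) : Measurable fun V => stickWeight V l := by
  unfold stickWeight
  fun_prop

/-- With `c = E V` and `d = E (1 - V)` the series is `∑ c d ^ l = c / (1 - d)`, and `c + d = 1`. The
exact value of `c` is irrelevant; only `c ≠ 0` is used. -/
theorem tsum_lintegral_stickWeight (α : ℝ) (hα : 0 < α) :
    ∑' l, ∫⁻ V, stickWeight V l ∂(stickLaw α hα) = 1 := by
  have := isProbabilityMeasureBeta one_pos hα
  simp_rw [lintegral_stickWeight, ENNReal.tsum_mul_left, ENNReal.tsum_geometric]
  set c := ∫⁻ v, ENNReal.ofReal v ∂(betaMeasure 1 α) with hc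
  set d := ∫⁻ v, ENNReal.ofReal (1 - v) ∂(betaMeasure 1 α)
  have hcd : c + d = 1 := by
    rw [← lintegral_add_left (by fun_prop)]
    have : ∀ᵐ v ∂(betaMeasure 1 α), ENNReal.ofReal v + ENNReal.ofReal (1 - v) = 1 := by
      filter_upwards [ae_mem_Ioo_betaMeasure 1 α] with v hv
      rw [← ENNReal.ofReal_add hv.1.le (by linarith [hv.2])]
      simp
    rw [lintegral_congr_ae this]
    simp
  have hc0 : c ≠ 0 := by
    intro h0
    rw [hc, lintegral_eq_zero_iff (by fun_prop)] at h0
    have : ∀ᵐ v ∂(betaMeasure 1 α), False := by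
      filter_upwards [h0, ae_mem_Ioo_betaMeasure 1 α] with v h1 h2
      exact absurd h2.1 (not_lt.2 (ENNReal.ofReal_eq_zero.1 h1))
    simp at this
    exact IsProbabilityMeasure.ne_zero _ this
  have hd : d ≠ ∞ := fun h => by simp [h] at hcd
  have hct : c ≠ ∞ := fun h => by simp [h] at hcd
  rw [← hcd, ENNReal.add_sub_cancel_right hd, ENNReal.mul_inv_cancel hc0 hct, hcd]

/-- Telescoping: the product on the right is the length of stick left after `n` breaks. -/
theorem sum_range_stick (V : ℕ → ℝ) (n : ℕ) :
    ∑ l ∈ Finset.range n, V l * ∏ i ∈ Finset.range l, (1 - V i) =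
      1 - ∏ i ∈ Finset.range n, (1 - V i) := by
  induction n with
  | zero => simp
  | succ n ih => rw [Finset.sum_range_succ, ih, Finset.prod_range_succ]; ring

/-- The total is at most `1` by telescoping and has mean exactly `1`, so it equals `1` almost
surely. This avoids showing that the infinite product of the `1 - V i` vanishes. -/
theorem ae_tsum_stickWeight (α : ℝ) (hα : 0 < α) :
    ∀ᵐ V ∂(stickLaw α hα), ∑' l, stickWeight V l = 1 := by
  have hint : ∫⁻ V, ∑' l, stickWeight V l ∂(stickLaw α hα) = 1 := by
    rw [lintegral_tsum fun l => (measurable_stickWeight l).aemeasurable,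
      tsum_lintegral_stickWeight]
  refine ae_eq_of_ae_le_of_lintegral_le ?_ (by simp [hint]) aemeasurable_const (by simp [hint])
  filter_upwards [ae_mem_Ioo_stickLaw α hα] with V hV
  refine ENNReal.tsum_le_of_sum_range_le fun n => ?_
  have h0 : ∀ n, 0 ≤ ∏ i ∈ Finset.range n, (1 - V i) := fun n =>
    Finset.prod_nonneg fun i _ => by linarith [(hV i).2]
  simp only [stickWeight]
  rw [← ENNReal.ofReal_sum_of_nonneg fun l _ => mul_nonneg (hV l).1.le (h0 l), sum_range_stick]
  exact ENNReal.ofReal_le_one.2 (by linarith [h0 n])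

/-! ### Mean measure of the Dirichlet process -/

section DirichletProcess

variable {Θ : Type*} [MeasurableSpace Θ]

theorem stickMeasure_apply (p : (ℕ → ℝ) × (ℕ → Θ)) {s : Set Θ} (hs : MeasurableSet s) :
    stickMeasure p s = ∑' l, stickWeight p.1 l * s.indicator 1 (p.2 l) := by
  simp [stickMeasure, Measure.sum_apply _ hs, Measure.dirac_apply' _ hs]

/-- A Dirichlet process is almost surely a probability measure. -/
theorem ae_dirichletProcess_univ (α : ℝ) (hα : 0 < α) (H : Measure Θ) [IsProbabilityMeasure H] :
    ∀ᵐ G ∂(dirichletProcess α hα H), G Set.univ = 1 := by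
  have hm : MeasurableSet {G : Measure Θ | G Set.univ = 1} :=
    (Measure.measurable_coe MeasurableSet.univ) (measurableSet_singleton 1)
  rw [dirichletProcess, ae_map_iff measurable_stickMeasure.aemeasurable hm]
  filter_upwards [Measure.quasiMeasurePreserving_fst.ae (ae_tsum_stickWeight α hα)] with p hp
  rw [stickMeasure_apply p MeasurableSet.univ]
  simpa using hp

/-- The mean measure of a Dirichlet process is its base distribution. -/
theorem lintegral_dirichletProcess_apply (α : ℝ) (hα : 0 < α) (H : Measure Θ)
    [IsProbabilityMeasure H] {s : Set Θ} (hs : MeasurableSet s) :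
    ∫⁻ G, G s ∂(dirichletProcess α hα H) = H s := by
  have hm : Measurable (s.indicator (1 : Θ → ℝ≥0∞)) := measurable_one.indicator hs
  rw [dirichletProcess, lintegral_map (Measure.measurable_coe hs) measurable_stickMeasure]
  simp_rw [stickMeasure_apply _ hs]
  have hsum : ∀ l, Measurable fun p : (ℕ → ℝ) × (ℕ → Θ) =>
      stickWeight p.1 l * s.indicator 1 (p.2 l) := fun l =>
    ((measurable_stickWeight l).comp measurable_fst).mul
      (hm.comp ((measurable_pi_apply l).comp measurable_snd))
  rw [lintegral_tsum fun l => (hsum l).aemeasurable]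
  have h : ∀ l, ∫⁻ p, stickWeight p.1 l * s.indicator 1 (p.2 l)
      ∂((stickLaw α hα).prod (Measure.infinitePi fun _ : ℕ => H)) =
      (∫⁻ V, stickWeight V l ∂(stickLaw α hα)) * H s := fun l => by
    -- Weights and atoms are independent, and every atom has law `H`, so `H s` factors out of each
    -- term.
    rw [lintegral_prod_mul (f := fun V => stickWeight V l) 
      (g := fun t : ℕ → Θ => s.indicator (1 : Θ → ℝ≥0∞) (t l))
      (measurable_stickWeight l).aemeasurable (hm.comp (measurable_pi_apply l)).aemeasurable,
      (measurePreserving_eval_infinitePi (fun _ : ℕ => H) l).lintegral_comp hm,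
      lintegral_indicator_one hs]
  simp_rw [h, ENNReal.tsum_mul_right, tsum_lintegral_stickWeight, one_mul]

/-- The truncation in `sampleKernel` is invisible here because `G` has mass one almost surely. -/
theorem lintegral_sampleKernel_dirichletProcess (α : ℝ) (hα : 0 < α) (H : Measure Θ)
    [IsProbabilityMeasure H] {s : Set Θ} (hs : MeasurableSet s) :
    ∫⁻ G, sampleKernel Θ G s ∂(dirichletProcess α hα H) = H s := by
  rw [← lintegral_dirichletProcess_apply α hα H hs]
  refine lintegral_congr_ae ?_
  filter_upwards [ae_dirichletProcess_univ α hα H] with G hG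
  change (if G Set.univ = 1 then G else 0) s = G s
  rw [if_pos hG]

/-- Integrating out a Dirichlet process: a draw from it follows the base distribution. -/
theorem map_compProd_dpKernel_sampleKernel {A : Type*} [MeasurableSpace A] (ν : Measure A)
    [SFinite ν] (α : ℝ) (hα : 0 < α) (κ : Kernel A Θ) [IsMarkovKernel κ] :
    ((ν ⊗ₘ dpKernel α hα κ) ⊗ₘ (sampleKernel Θ).prodMkLeft A).map (fun p => (p.1.1, p.2)) =
      ν ⊗ₘ κ := by
  ext s hs
  have hf : Measurable fun p : (A × Measure Θ) × Θ => (p.1.1, p.2) := by fun_prop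
  rw [Measure.map_apply hf hs, Measure.compProd_apply (hf hs), Measure.compProd_apply hs,
    Measure.lintegral_compProd (Kernel.measurable_kernel_prodMk_left (hf hs))]
  refine lintegral_congr fun a => ?_
  exact lintegral_sampleKernel_dirichletProcess α hα (κ a) (measurable_prodMk_left hs)

end DirichletProcess

/-! ### Evidence, likelihood update and Bayes' formula -/

namespace DDPModel

variable {Θ X Z : Type*} [MeasurableSpace Θ] [MeasurableSpace Z] (M : DDPModel Θ X Z)
variable {N : ℕ} {ℓ : Fin N}

theorem measurable_R_coe (x : X) : Measurable fun p : Θ × Z => (M.R x p.1 p.2 : ℝ≥0∞) :=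
  measurable_coe_nnreal_ennreal.comp (M.R_measurable x)

theorem measurable_R_left (x : X) (z : Z) : Measurable fun t => (M.R x t z : ℝ≥0∞) :=
  (M.measurable_R_coe x).comp measurable_prodMk_right

/-- The evidence is the integral of the likelihood against the base distribution. -/
theorem evidence_eq_lintegral [Nonempty Θ] (x : X) (w : M.Config ℓ) (z : Z) :
    M.evidence x w z = ∫⁻ t, M.R x t z ∂(M.baseMeasure w) := by
  have h := M.measurable_R_left x z
  simp only [baseMeasure, evidence, lintegral_add_measure, lintegral_finsetSum_measure,
    lintegral_smul_measure, lintegral_dirac' _ h, smul_eq_mul]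

theorem measurable_evidence [Nonempty Θ] (x : X) :
    Measurable fun y : M.Config ℓ × Z => M.evidence x y.1 y.2 := by
  simp_rw [evidence_eq_lintegral]
  have h : Measurable fun p : (M.Config ℓ × Z) × Θ => (M.R x p.2 p.1.2 : ℝ≥0∞) :=
    (M.measurable_R_coe x).comp (by fun_prop : Measurable fun p : (M.Config ℓ × Z) × Θ =>
      (p.2, p.1.2))
  exact h.lintegral_kernel_prod_right' (κ := (M.baseKernel ℓ).prodMkRight Z)

theorem measurable_uncurry_evidence [Nonempty Θ] (x : X) :
    Measurable (Function.uncurry fun (w : M.Config ℓ) z => M.evidence x w z) :=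
  M.measurable_evidence x

theorem measurable_evidence_right [Nonempty Θ] (x : X) (w : M.Config ℓ) :
    Measurable fun z => M.evidence x w z := by
  simp_rw [evidence_eq_lintegral]
  exact (M.measurable_R_coe x).lintegral_prod_left'

theorem lintegral_likelihoodUpdate (x : X) (z : Z) (μ : Measure Θ) {f : Θ → ℝ≥0∞}
    (hf : Measurable f) :
    ∫⁻ t, f t ∂(M.likelihoodUpdate x z μ) =
      (∫⁻ t, M.R x t z ∂μ)⁻¹ * ∫⁻ t, M.R x t z * f t ∂μ := by
  rw [likelihoodUpdate, lintegral_smul_measure,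
    lintegral_withDensity_eq_lintegral_mul _ (M.measurable_R_left x z) hf]
  rfl

theorem likelihoodUpdate_univ (x : X) (z : Z) (μ : Measure Θ) :
    M.likelihoodUpdate x z μ Set.univ =
      (∫⁻ t, M.R x t z ∂μ)⁻¹ * ∫⁻ t, M.R x t z ∂μ := by
  simp [likelihoodUpdate]

theorem isProbabilityMeasure_likelihoodUpdate (x : X) (z : Z) (μ : Measure Θ)
    (h0 : ∫⁻ t, M.R x t z ∂μ ≠ 0) (h1 : ∫⁻ t, M.R x t z ∂μ ≠ ∞) :
    IsProbabilityMeasure (M.likelihoodUpdate x z μ) :=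
  ⟨by rw [likelihoodUpdate_univ, ENNReal.inv_mul_cancel h0 h1]⟩

/-- The likelihood update of the base distribution, as a kernel. -/
noncomputable def posteriorKernel [Nonempty Θ] (ℓ : Fin N) (x : X) :
    Kernel (M.Config ℓ × Z) Θ where
  toFun y := M.likelihoodUpdate x y.2 (M.baseMeasure y.1)
  measurable' := by
    refine Measure.measurable_of_measurable_coe _ fun s hs => ?_
    have e : ∀ y : M.Config ℓ × Z, M.likelihoodUpdate x y.2 (M.baseMeasure y.1) s =
        (M.evidence x y.1 y.2)⁻¹ *
          ∫⁻ t, M.R x t y.2 * s.indicator 1 t ∂((M.baseKernel ℓ).prodMkRight Z y) := fun y => by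
      rw [← lintegral_indicator_one hs,
        M.lintegral_likelihoodUpdate _ _ _ (measurable_one.indicator hs), evidence_eq_lintegral]
      rfl
    simp_rw [e]
    have h : Measurable fun p : (M.Config ℓ × Z) × Θ =>
        (M.R x p.2 p.1.2 : ℝ≥0∞) * s.indicator 1 p.2 :=
      ((M.measurable_R_coe x).comp (by fun_prop : Measurable fun p : (M.Config ℓ × Z) × Θ =>
        (p.2, p.1.2))).mul ((measurable_one.indicator hs).comp measurable_snd)
    exact (M.measurable_evidence x).inv.mul h.lintegral_kernel_prod_right'

/-- In `ℝ≥0∞`, `I⁻¹ * I` is `1` for `0 < I < ∞` and `0` otherwise. The kernel is thus finite without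
any condition, but has mass zero where the evidence degenerates. -/
instance [Nonempty Θ] (x : X) : IsFiniteKernel (M.posteriorKernel ℓ x) :=
  ⟨1, ENNReal.one_lt_top, fun y =>
    (M.likelihoodUpdate_univ x y.2 (M.baseMeasure y.1)).trans_le (ENNReal.inv_mul_le_one _)⟩

/-- The law of the measurement given the configuration of the other objects. -/
noncomputable def evidenceKernel [Nonempty Θ] (ℓ : Fin N) (x : X) : Kernel (M.Config ℓ) Z :=
  (Kernel.const _ M.ref).withDensity fun w z => M.evidence x w z

theorem lintegral_evidenceKernel [Nonempty Θ] (x : X) (w : M.Config ℓ) {f : Z → ℝ≥0∞}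
    (hf : Measurable f) :
    ∫⁻ z, f z ∂(M.evidenceKernel ℓ x w) = ∫⁻ z, M.evidence x w z * f z ∂M.ref := by
  rw [evidenceKernel, Kernel.lintegral_withDensity _ (M.measurable_uncurry_evidence x) _ hf,
    Kernel.const_apply]

/-- Tonelli: each density `R x t` integrates to one, and `H₀(w)` is a probability measure. -/
theorem lintegral_evidence [Nonempty Θ] (x : X) (w : M.Config ℓ) :
    ∫⁻ z, M.evidence x w z ∂M.ref = 1 := by
  simp_rw [evidence_eq_lintegral]
  rw [lintegral_lintegral_swap]
  · simp [M.R_lintegral]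
  · exact ((M.measurable_R_coe x).comp measurable_swap).aemeasurable

theorem ae_evidence_lt_top [Nonempty Θ] (x : X) (w : M.Config ℓ) :
    ∀ᵐ z ∂M.ref, M.evidence x w z < ∞ :=
  ae_lt_top (M.measurable_evidence_right x w) (by simp [lintegral_evidence])

instance [Nonempty Θ] (x : X) : IsMarkovKernel (M.evidenceKernel ℓ x) :=
  ⟨fun w => ⟨by
    have h := M.lintegral_evidenceKernel x w (f := fun _ => 1) measurable_const
    simpa [lintegral_evidence] using h⟩⟩

theorem lintegral_measurementKernel (x : X) (t : Θ) {f : Z → ℝ≥0∞} (hf : Measurable f) :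
    ∫⁻ z, f z ∂(M.measurementKernel x t) = ∫⁻ z, M.R x t z * f z ∂M.ref := by
  rw [measurementKernel, Kernel.lintegral_withDensity _ (M.measurable_R_coe x) _ hf,
    Kernel.const_apply]

/-- Bayes' formula pointwise in the data. -/
theorem evidence_mul_lintegral_posterior [Nonempty Θ] (x : X) (w : M.Config ℓ) (z : Z)
    (h : M.evidence x w z ≠ ∞) {f : Θ → ℝ≥0∞} (hf : Measurable f) :
    M.evidence x w z * ∫⁻ t, f t ∂(M.likelihoodUpdate x z (M.baseMeasure w)) =
      ∫⁻ t, M.R x t z * f t ∂(M.baseMeasure w) := by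
  rw [M.lintegral_likelihoodUpdate _ _ _ hf, ← evidence_eq_lintegral, ← mul_assoc]
  -- If the evidence is zero, the likelihood vanishes almost everywhere for the base measure, so
  -- both sides are zero.
  by_cases h0 : M.evidence x w z = 0
  · rw [h0, zero_mul, zero_mul]
    rw [evidence_eq_lintegral, lintegral_eq_zero_iff (M.measurable_R_left x z)] at h0
    refine (lintegral_eq_zero_of_ae_eq_zero ?_).symm
    filter_upwards [h0] with t ht
    simp only [Pi.zero_apply] at ht
    simp [ht]
  · rw [ENNReal.mul_inv_cancel h0 h, one_mul]

/-- Disintegration of the joint law of configuration, measurement and cluster parameter. -/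
theorem map_compProd_measurementKernel [Nonempty Θ] (x : X) (ν : Measure (M.Config ℓ))
    [SFinite ν] :
    ((ν ⊗ₘ M.baseKernel ℓ) ⊗ₘ (M.measurementKernel x).prodMkLeft (M.Config ℓ)).map
        (fun p => ((p.1.1, p.2), p.1.2)) =
      (ν ⊗ₘ M.evidenceKernel ℓ x) ⊗ₘ M.posteriorKernel ℓ x := by
  have hg : Measurable fun p : (M.Config ℓ × Θ) × Z => ((p.1.1, p.2), p.1.2) := by fun_prop
  refine Measure.ext_of_lintegral _ fun f hf => ?_
  have hf' : Measurable fun p : (M.Config ℓ × Θ) × Z => f ((p.1.1, p.2), p.1.2) := hf.comp hg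
  have h1 : ∀ w t, ∫⁻ z, f ((w, z), t) ∂((M.measurementKernel x).prodMkLeft (M.Config ℓ) (w, t)) =
      ∫⁻ z, M.R x t z * f ((w, z), t) ∂M.ref := fun w t =>
    M.lintegral_measurementKernel x t (hf'.comp (measurable_prodMk_left (x := (w, t))))
  rw [lintegral_map hf hg, Measure.lintegral_compProd hf',
    Measure.lintegral_compProd hf'.lintegral_kernel_prod_right',
    Measure.lintegral_compProd hf, Measure.lintegral_compProd hf.lintegral_kernel_prod_right']
  refine lintegral_congr fun w => ?_
  have hw : Measurable fun p : Θ × Z => (M.R x p.1 p.2 : ℝ≥0∞) * f ((w, p.2), p.1) :=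
    (M.measurable_R_coe x).mul (hf.comp (by fun_prop))
  simp_rw [h1]
  have hpost : Measurable fun z => ∫⁻ t, f ((w, z), t) ∂(M.posteriorKernel ℓ x (w, z)) :=
    hf.lintegral_kernel_prod_right'.comp (measurable_prodMk_left (x := w))
  -- Exchanging `t` and `z` leaves Bayes' formula for each fixed `z`, which needs finite evidence
  -- and so holds for almost every `z`.
  rw [lintegral_lintegral_swap hw.aemeasurable, M.lintegral_evidenceKernel x w hpost]
  refine lintegral_congr_ae ?_
  filter_upwards [M.ae_evidence_lt_top x w] with z hz
  exact (M.evidence_mul_lintegral_posterior x w z hz.ne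
    (hf.comp measurable_prodMk_left)).symm

/-- Joint law of configuration, measurement and cluster parameter, the random measure being
integrated out. -/
theorem map_jointLaw [Nonempty Θ] (x : X) (ν : Measure (M.Config ℓ)) [SFinite ν] :
    (M.jointLaw ℓ x ν).map (fun p => ((p.1.1.1, p.2), p.1.2)) =
      (ν ⊗ₘ M.evidenceKernel ℓ x) ⊗ₘ M.posteriorKernel ℓ x := by
  rw [← map_compProd_measurementKernel,
    ← map_compProd_dpKernel_sampleKernel ν M.α M.α_pos (M.baseKernel ℓ), jointLaw]
  refine Measure.ext_of_lintegral _ fun f hf => ?_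
  have hq : Measurable fun p : (M.Config ℓ × Measure Θ) × Θ => (p.1.1, p.2) := by fun_prop
  have hg : Measurable fun p : (M.Config ℓ × Θ) × Z => ((p.1.1, p.2), p.1.2) := by fun_prop
  have hk : Measurable fun p : ((M.Config ℓ × Measure Θ) × Θ) × Z =>
    ((p.1.1.1, p.2), p.1.2) := by fun_prop
  have hfg : Measurable fun p : (M.Config ℓ × Θ) × Z => f ((p.1.1, p.2), p.1.2) := hf.comp hg
  have hfk : Measurable fun p : ((M.Config ℓ × Measure Θ) × Θ) × Z =>
    f ((p.1.1.1, p.2), p.1.2) := hf.comp hk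
  rw [lintegral_map hf hk, lintegral_map hf hg, Measure.lintegral_compProd hfk,
    Measure.lintegral_compProd hfg, lintegral_map hfg.lintegral_kernel_prod_right' hq]
  -- The measurement kernel ignores `G`, so both sides are the same iterated integral.
  rfl

/-- A law does not charge the zeros of its own density, and a density of integral one is almost
everywhere finite. -/
theorem ae_evidence_mem_Ioo [Nonempty Θ] (x : X) (ν : Measure (M.Config ℓ)) [SFinite ν] :
    ∀ᵐ y ∂(ν ⊗ₘ M.evidenceKernel ℓ x), 0 < M.evidence x y.1 y.2 ∧ M.evidence x y.1 y.2 < ∞ := by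
  have hm : MeasurableSet {y : M.Config ℓ × Z |
      0 < M.evidence x y.1 y.2 ∧ M.evidence x y.1 y.2 < ∞} :=
    M.measurable_evidence x measurableSet_Ioo
  refine Measure.ae_compProd_of_ae_ae hm (Filter.Eventually.of_forall fun w => ?_)
  rw [evidenceKernel, Kernel.withDensity_apply _ (M.measurable_uncurry_evidence x),
    Kernel.const_apply, ae_withDensity_iff (M.measurable_evidence_right x w)]
  filter_upwards [M.ae_evidence_lt_top x w] with z hz h0
  exact ⟨pos_iff_ne_zero.2 h0, hz⟩

/-! ### Posterior of a mixture -/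

/-- The evidence of a component in its weight cancels its normalizing constant. If that evidence is
`0`, the weighted measure is already zero; if it is `∞`, the hypothesis forces `c = 0`. -/
theorem smul_likelihoodUpdate (x : X) (z : Z) (μ : Measure Θ) (c e : ℝ≥0∞)
    (h : c * ∫⁻ t, M.R x t z ∂μ ≠ ∞) :
    (c * (∫⁻ t, M.R x t z ∂μ) / e) • M.likelihoodUpdate x z μ =
      (e⁻¹ * c) • μ.withDensity fun t => (M.R x t z : ℝ≥0∞) := by
  rw [likelihoodUpdate, smul_smul]
  by_cases h0 : ∫⁻ t, M.R x t z ∂μ = 0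
  · have : μ.withDensity (fun t => (M.R x t z : ℝ≥0∞)) = 0 := by
      rw [← Measure.measure_univ_eq_zero, withDensity_apply _ MeasurableSet.univ,
        Measure.restrict_univ, h0]
    rw [this, smul_zero, smul_zero]
  by_cases h1 : ∫⁻ t, M.R x t z ∂μ = ∞
  · have hc : c = 0 := by
      by_contra hc
      exact h (by rw [h1, ENNReal.mul_top hc])
    simp [hc]
  · congr 1
    rw [div_eq_mul_inv, mul_comm c, mul_right_comm, mul_right_comm (∫⁻ t, M.R x t z ∂μ),
      mul_right_comm, ENNReal.mul_inv_cancel h0 h1]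
    ring

section Weights

variable [Nonempty Θ] {x : X} {w : M.Config ℓ} {z : Z}

/-- The numerators of the weights add up to the evidence. -/
theorem sum_posterior_weights (h0 : M.evidence x w z ≠ 0) (h1 : M.evidence x w z ≠ ∞) :
    ∑ a ∈ M.occupied w.1, M.ξ x w z a + ∑ j ∈ M.free w.1, M.β x w z j
      + M.prob₃ N * (∫⁻ t, M.R x t z ∂M.H) / M.evidence x w z = 1 := by
  simp only [ξ, β, div_eq_mul_inv]
  rw [← Finset.sum_mul, ← Finset.sum_mul, ← add_mul, ← add_mul]
  exact ENNReal.mul_inv_cancel h0 h1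

theorem γ_eq (h0 : M.evidence x w z ≠ 0) (h1 : M.evidence x w z ≠ ∞) :
    M.γ x w z = M.prob₃ N * (∫⁻ t, M.R x t z ∂M.H) / M.evidence x w z := by
  have h := M.sum_posterior_weights h0 h1
  -- `γ` is a truncated difference in `ℝ≥0∞`; cancelling requires the subtracted mass to be finite.
  have hne : ∑ a ∈ M.occupied w.1, M.ξ x w z a + ∑ j ∈ M.free w.1, M.β x w z j ≠ ∞ := by
    intro ht
    simp [ht] at h
  rw [γ, tsub_tsub, ← h, ENNReal.add_sub_cancel_left hne]

/-- The product is a summand of the evidence. The integral alone may be infinite when the prior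
weight is zero. -/
theorem prob₂_mul_ne_top (h1 : M.evidence x w z ≠ ∞) {j : Fin M.D} (hj : j ∈ M.free w.1) :
    M.prob₂ N j * ∫⁻ t, M.R x t z ∂(M.φ (M.param j)) ≠ ∞ := by
  have hs : ∑ j ∈ M.free w.1, M.prob₂ N j * ∫⁻ t, M.R x t z ∂(M.φ (M.param j)) ≠ ∞ :=
    ne_top_of_le_ne_top h1 (le_add_right le_add_self)
  exact (ENNReal.lt_top_of_sum_ne_top hs hj).ne

theorem prob₃_mul_ne_top (h1 : M.evidence x w z ≠ ∞) :
    M.prob₃ N * ∫⁻ t, M.R x t z ∂M.H ≠ ∞ :=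
  ne_top_of_le_ne_top h1 le_add_self

/-- The mixture is the likelihood update of the base distribution. -/
theorem likelihoodUpdate_baseMeasure (h0 : M.evidence x w z ≠ 0) (h1 : M.evidence x w z ≠ ∞) :
    M.likelihoodUpdate x z (M.baseMeasure w) = M.gibbsMixture x w z := by
  have hR := M.measurable_R_left x z
  have hβ : ∑ j ∈ M.free w.1, M.β x w z j • M.likelihoodUpdate x z (M.φ (M.param j)) =
      ∑ j ∈ M.free w.1, ((M.evidence x w z)⁻¹ * M.prob₂ N j) •
        (M.φ (M.param j)).withDensity fun t => (M.R x t z : ℝ≥0∞) :=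
    Finset.sum_congr rfl fun j hj =>
      M.smul_likelihoodUpdate x z _ _ _ (M.prob₂_mul_ne_top h1 hj)
  rw [gibbsMixture, M.γ_eq h0 h1, M.smul_likelihoodUpdate _ _ _ _ _ (M.prob₃_mul_ne_top h1), hβ,
    likelihoodUpdate, ← evidence_eq_lintegral]
  -- Tested against `f`, both sides are finite sums over the same components; on a point mass the
  -- likelihood acts as a scalar.
  refine Measure.ext_of_lintegral _ fun f hf => ?_
  have hRf : Measurable fun t => (M.R x t z : ℝ≥0∞) * f t := hR.mul hf
  simp only [baseMeasure, lintegral_add_measure, lintegral_finsetSum_measure,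
    lintegral_smul_measure, lintegral_withDensity_eq_lintegral_mul _ hR hf, Pi.mul_apply,
    lintegral_dirac' _ hRf, lintegral_dirac' _ hf, smul_eq_mul, ξ, mul_add, Finset.mul_sum,
    mul_assoc, div_eq_mul_inv]
  congr 2
  exact Finset.sum_congr rfl fun a _ => by ring

theorem ne_zero_and_ne_top_of_mul_div {c I e : ℝ≥0∞} (h : c * I ≠ ∞) (h0 : c * I / e ≠ 0) :
    I ≠ 0 ∧ I ≠ ∞ := by
  refine ⟨fun hI => h0 (by simp [hI]), fun hI => h0 ?_⟩
  have hc : c = 0 := by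
    by_contra hc
    exact h (by rw [hI, ENNReal.mul_top hc])
  simp [hc]

end Weights

end DDPModel

/-! ### Identification of the conditional distribution -/

theorem mainTheorem2 {Θ X Z Ω : Type*}
    [MeasurableSpace Θ] [StandardBorelSpace Θ] [Nonempty Θ]
    [MeasurableSpace Z] [MeasurableSpace Ω]
    (M : DDPModel Θ X Z) {N : ℕ} (ℓ : Fin N) (x : X)
    (P : Measure Ω) [IsProbabilityMeasure P]
    (ν : Measure (M.Config ℓ)) [IsProbabilityMeasure ν]
    (W : Ω → M.Config ℓ) (G : Ω → Measure Θ) (θ : Ω → Θ) (z : Ω → Z)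
    (hlaw : HasLaw (fun ω => (((W ω, G ω), θ ω), z ω)) (M.jointLaw ℓ x ν) P) :
    ∀ᵐ y ∂(P.map fun ω => (W ω, z ω)),
      condDistrib θ (fun ω => (W ω, z ω)) P y = M.gibbsMixture x y.1 y.2 ∧
      (0 < M.evidence x y.1 y.2 ∧ M.evidence x y.1 y.2 < ∞) ∧
      M.γ x y.1 y.2 = M.prob₃ N * (∫⁻ t, M.R x t y.2 ∂M.H) / M.evidence x y.1 y.2 ∧
      ∑ a ∈ M.occupied y.1.1, M.ξ x y.1 y.2 a + ∑ j ∈ M.free y.1.1, M.β x y.1 y.2 j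
        + M.γ x y.1 y.2 = 1 ∧
      (∀ j ∈ M.free y.1.1, M.β x y.1 y.2 j ≠ 0 →
        IsProbabilityMeasure (M.likelihoodUpdate x y.2 (M.φ (M.param j)))) ∧
      (M.γ x y.1 y.2 ≠ 0 → IsProbabilityMeasure (M.likelihoodUpdate x y.2 M.H)) := by
  have hg : Measurable fun p : ((M.Config ℓ × Measure Θ) × Θ) × Z =>
    ((p.1.1.1, p.2), p.1.2) := by fun_prop
  have hthird : Measurable fun p : ((M.Config ℓ × Measure Θ) × Θ) × Z => p.1.2 := by fun_prop
  have hjoint : P.map (fun ω => ((W ω, z ω), θ ω)) =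
      (ν ⊗ₘ M.evidenceKernel ℓ x) ⊗ₘ M.posteriorKernel ℓ x := by
    rw [← M.map_jointLaw, ← hlaw.map_eq,
      AEMeasurable.map_map_of_aemeasurable hg.aemeasurable hlaw.aemeasurable]
    rfl
  have hpair : AEMeasurable (fun ω => ((W ω, z ω), θ ω)) P :=
    hg.comp_aemeasurable hlaw.aemeasurable
  -- `posteriorKernel` need not be Markov, so mass one almost everywhere is what identifies the data
  -- law as the first marginal.
  have hpost : ∀ᵐ y ∂(ν ⊗ₘ M.evidenceKernel ℓ x),
      M.posteriorKernel ℓ x y Set.univ = 1 := by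
    filter_upwards [M.ae_evidence_mem_Ioo x ν] with y hy
    have := M.isProbabilityMeasure_likelihoodUpdate x y.2 (M.baseMeasure y.1)
      (by rw [← M.evidence_eq_lintegral]; exact hy.1.ne')
      (by rw [← M.evidence_eq_lintegral]; exact hy.2.ne)
    exact this.measure_univ
  have hdata : P.map (fun ω => (W ω, z ω)) = ν ⊗ₘ M.evidenceKernel ℓ x := by
    have e : P.map (fun ω => (W ω, z ω)) = (P.map (fun ω => ((W ω, z ω), θ ω))).map Prod.fst := by
      rw [AEMeasurable.map_map_of_aemeasurable measurable_fst.aemeasurable hpair]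
      rfl
    ext s hs
    rw [e, hjoint, Measure.map_apply measurable_fst hs, ← Set.prod_univ,
      Measure.compProd_apply_prod hs MeasurableSet.univ,
      lintegral_congr_ae (ae_restrict_of_ae hpost), setLIntegral_one]
  have hθ : AEMeasurable θ P := hthird.comp_aemeasurable hlaw.aemeasurable
  -- Almost sure uniqueness of disintegrations, `Θ` being standard Borel.
  have hcond := condDistrib_ae_eq_of_measure_eq_compProd (fun ω => (W ω, z ω)) hθ
    (κ := M.posteriorKernel ℓ x) (by rw [hjoint, hdata])
  have hev := M.ae_evidence_mem_Ioo x ν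
  rw [← hdata] at hev
  filter_upwards [hcond, hev] with y hy he
  have h0 := he.1.ne'
  have h1 := he.2.ne
  refine ⟨hy.trans (M.likelihoodUpdate_baseMeasure h0 h1), he, M.γ_eq h0 h1, ?_, ?_, ?_⟩
  · rw [M.γ_eq h0 h1]
    exact M.sum_posterior_weights h0 h1
  · intro j hj hβ
    obtain ⟨a, b⟩ := DDPModel.ne_zero_and_ne_top_of_mul_div (M.prob₂_mul_ne_top h1 hj) hβ
    exact M.isProbabilityMeasure_likelihoodUpdate x _ _ a b
  · intro hγ
    rw [M.γ_eq h0 h1] at hγ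
    obtain ⟨a, b⟩ := DDPModel.ne_zero_and_ne_top_of_mul_div (M.prob₃_mul_ne_top h1) hγ
    exact M.isProbabilityMeasure_likelihoodUpdate x _ _ a b
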